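/- **Notions.** A real function $h\ge 0$ on $\mathbb R$ has a *finite improper Riemann integral* if for all $M,R>0$ the truncation $\min(h,M)$ is Riemann integrable on $[-R,R]$ and $\int_{-\infty}^{\infty}h(x)\,dx:=\lim_{M,R\to\infty}\int_{-R}^{R}\min(h(x),M)\,dx$ exists and is finite. For $1\le p<\infty$ let $\mathsf R^p(\mathbb R;\mathbb C)$ be the set of all $f:\mathbb R\to\mathbb C$ such that $\int_{-\infty}^\infty|f(x)|^p\,dx$ is finite in this sense and $f$ is locally Riemann integrable up to unboundedness, i.e. for $g=\operatorname{Re}f$ and $g=\operatorname{Im}f$ the function $\max(-M,\min(g,M))$ is Riemann integrable on $[-R,R]$ for all $M,R>0$. Put $\|f\|_p=\bigl(\int_{-\infty}^\infty|f(x)|^p\,dx\bigr)^{1/p}$, let $[f]$ be the class of $f$ modulo almost everywhere equality, and let $\hat{\mathsf R}^p(\mathbb R;\mathbb C)=\{[f]: f\in\mathsf R^p(\mathbb R;\mathbb C)\}$. Let $\mathscr F_2$ be the $L^2$-Fourier transform, i.e. the unitary operator on $\hat{\mathsf L}^2(\mathbb R;\mathbb C)$ extending $\mathscr F(f)(\omega)=\int_{\mathbb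 R} f(x)e^{-2\pi i\omega x}\,dx$. Let $\ell\in(0,1)$, let $(q_j)_{j\ge1}$ be an enumeration of $\mathbb Q\cap[0,1]$, let $$A=\bigcup_{j=1}^\infty\Bigl([0,1]\cap\bigl(q_j-\tfrac{\ell}{2^{j+1}},\,q_j+\tfrac{\ell}{2^{j+1}}\bigr)\Bigr),$$ let $G:\mathbb R\to\mathbb C$ be the indicator function of $A$, and let $F(x)=\int_{\mathbb R}G(t)e^{2\pi i x t}\,dt$. **Theorem.** 1. For every $1\le p<\infty$: $\mathsf R^p(\mathbb R;\mathbb C)$ is a complex vector space; every $f\in\mathsf R^p(\mathbb R;\mathbb C)$ lies in $\mathsf L^p(\mathbb R;\mathbb C)$, and $\|f\|_p$ equals its $\mathsf L^p$-norm, so that $\hat{\mathsf R}^p(\mathbb R;\mathbb C)$ is a normed subspace of $\hat{\mathsf L}^p(\mathbb R;\mathbb C)$; and $\hat{\mathsf R}^p(\mathbb R;\mathbb C)$ is not complete: some sequence in $\mathsf R^p(\mathbb R;\mathbb C)$ is Cauchy for $\|\cdot\|_p$ but converges in $\|\cdot\|_p$ to no element of $\mathsf R^p(\mathbb R;\mathbb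 C)$. 2. $\mathscr F_2$ does not map $\hat{\mathsf R}^2(\mathbb R;\mathbb C)$ into itself. 3. More precisely, for all $\ell$ and $(q_j)$ as above: $G\in \mathsf L^1(\mathbb R;\mathbb C)\cap \mathsf L^2(\mathbb R;\mathbb C)$; $F$ is continuous and square integrable, $|F|^2$ is Riemann integrable on each $[-R,R]$, $\lim_{R\to\infty}\int_{-R}^R|F(x)|^2\,dx$ exists and is finite, and $F\in\mathsf R^2(\mathbb R;\mathbb C)$; $\mathscr F_2([F])=[G]$; and $[G]\notin\hat{\mathsf R}^2(\mathbb R;\mathbb C)$. Indeed, for every $p\in[1,\infty)$ and every $g:\mathbb R\to\mathbb C$ equal to $G$ almost everywhere, $|g|^p$ does not have a finite improper Riemann integral. -/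

import Mathlib

open MeasureTheory Filter Topology Set
open scoped ENNReal FourierTransform

noncomputable section

namespace RiemannFourier

/-- The interval from `a` to `b`, as a one-dimensional box. -/
def intervalBox (a b : ℝ) (h : a < b) : BoxIntegral.Box (Fin 1) where
  lower := fun _ => a
  upper := fun _ => b
  lower_lt_upper := fun _ => h

/-- `f` is (properly) Riemann integrable on `[a, b]`, where `a < b`: its Riemann sums over tagged
partitions of `[a, b]` converge as the mesh tends to `0`. -/
def RiemannIntegrableOn (f : ℝ → ℝ) (a b : ℝ) : Prop :=
  ∃ h : a < b, BoxIntegral.Integrable (intervalBox a b h) BoxIntegral.IntegrationParams.Riemann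
    (fun x : Fin 1 → ℝ => f (x 0)) BoxIntegral.BoxAdditiveMap.volume

open scoped Classical in
/-- The Riemann integral of `f` over `[a, b]`, where `a < b`. -/
def riemannIntegral (f : ℝ → ℝ) (a b : ℝ) : ℝ :=
  if h : a < b then
    BoxIntegral.integral (intervalBox a b h) BoxIntegral.IntegrationParams.Riemann
      (fun x : Fin 1 → ℝ => f (x 0)) BoxIntegral.BoxAdditiveMap.volume
  else 0

/-- The improper Riemann integral over `ℝ` of a nonnegative, possibly unbounded function `h` exists
and equals `c`: each truncation `min h M` is Riemann integrable on each `[-R, R]`, and these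
integrals (which increase with `M` and `R`) tend to `c` as `M, R → ∞`. -/
def HasImproperRiemannIntegral (h : ℝ → ℝ) (c : ℝ) : Prop :=
  (∀ M R : ℝ, 0 < M → 0 < R → RiemannIntegrableOn (fun x => min (h x) M) (-R) R) ∧
    Tendsto (fun q : ℝ × ℝ => riemannIntegral (fun x => min (h x) q.1) (-q.2) q.2)
      (atTop ×ˢ atTop) (𝓝 c)

/-- A nonnegative function `h` has a finite improper Riemann integral over `ℝ`. -/
def ImproperRiemannIntegrable (h : ℝ → ℝ) : Prop :=
  ∃ c : ℝ, HasImproperRiemannIntegral h c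

open scoped Classical in
/-- The improper Riemann integral over `ℝ` of a nonnegative function. -/
def improperRiemannIntegral (h : ℝ → ℝ) : ℝ :=
  if H : ImproperRiemannIntegrable h then H.choose else 0

/-- The real function `g` is locally Riemann integrable up to unboundedness: its truncations
`max (-M) (min g M)` are Riemann integrable on each `[-R, R]`. -/
def LocallyRiemann (g : ℝ → ℝ) : Prop :=
  ∀ M R : ℝ, 0 < M → 0 < R → RiemannIntegrableOn (fun x => max (-M) (min (g x) M)) (-R) R

/-- The functions `f : ℝ → ℂ` which are locally Riemann integrable (up to unboundedness) and for
which the improper Riemann integral of `|f| ^ p` over `ℝ` is finite. -/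
def RiemannLp (p : ℝ≥0∞) : Set (ℝ → ℂ) :=
  {f | LocallyRiemann (fun x => (f x).re) ∧ LocallyRiemann (fun x => (f x).im) ∧
    ImproperRiemannIntegrable (fun x => ‖f x‖ ^ p.toReal)}

/-- The seminorm `(∫ |f| ^ p) ^ (1 / p)`, with an improper Riemann integral. -/
def riemannLpNorm (p : ℝ≥0∞) (f : ℝ → ℂ) : ℝ :=
  (improperRiemannIntegral (fun x => ‖f x‖ ^ p.toReal)) ^ (1 / p.toReal)

/-- The classes modulo almost everywhere equality of the functions in `RiemannLp p`, as a set of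
elements of `L^p`. -/
def RiemannLpHat (p : ℝ≥0∞) : Set (Lp ℂ p (volume : Measure ℝ)) :=
  {u | ∃ f ∈ RiemannLp p, (u : ℝ → ℂ) =ᵐ[volume] f}

/-- The set `A`: the union over `j` of `[0, 1]` intersected with the open interval centred at
`q j` whose length is `ℓ / 2 ^ (j + 1)` (the enumeration `q` starts with the index `0`). -/
def openCover (ℓ : ℝ) (q : ℕ → ℝ) : Set ℝ :=
  ⋃ j : ℕ, Icc 0 1 ∩ Ioo (q j - ℓ / 2 ^ (j + 2)) (q j + ℓ / 2 ^ (j + 2))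

/-- The indicator function `G` of `A`, on the whole real line. -/
def indG (ℓ : ℝ) (q : ℕ → ℝ) : ℝ → ℂ :=
  (openCover ℓ q).indicator (fun _ => 1)

/-- The inverse Fourier transform `F` of `G`. -/
def invFT (ℓ : ℝ) (q : ℕ → ℝ) (x : ℝ) : ℂ :=
  ∫ t : ℝ, indG ℓ q t * Complex.exp (2 * Real.pi * Complex.I * x * t)

end RiemannFourier

end

open RiemannFourier

/-! Everything reduces to Lebesgue's criterion. A bounded function is Riemann integrable on all
`[-R, R]` exactly when it is almost everywhere continuous; truncating carries this to unbounded
functions (`locallyRiemann_iff`), and dominated and monotone convergence identify finite improper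
integrals with Lebesgue integrals (`improperRiemannIntegrable_iff`). Hence `RiemannLp p` is the set
of almost everywhere continuous functions in `L^p` (`mem_riemannLp_iff`), and the linear structure
and the equality of norms follow.

The obstruction is `A`: it has measure at most `ℓ < 1` but is dense in `[0, 1]`. A function equal to
`G` almost everywhere and continuous at a point of `[0, 1]` outside `A`, where it agrees with `G`,
would be near `0` around that point, yet it is `1` almost everywhere on an open piece of `A` there
(`not_ae_continuousAt_of_ae_eq`). Finite unions of the intervals have null frontier and their
indicators tend to `G` in `L^p`, which refutes completeness. On the Fourier side, `F` is the inverse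
transform of an `L¹ ∩ L²` function, so it is continuous and in `L²`, and the `L²` transform sends it
back to `G` (`fourier_toLp_invFT`). -/

namespace RiemannFourier

/-! ### Riemann integrability implies almost everywhere continuity -/

section BoxIntegral

open BoxIntegral

variable {ι : Type*} [Fintype ι]

/-- The points at which the oscillation of a function is at least `ε`. -/
def oscSet (f : (ι → ℝ) → ℝ) (ε : ℝ) : Set (ι → ℝ) :=
  {x | ∃ᶠ y in 𝓝 x, ε ≤ |f y - f x|}

/-- A box whose points lie within `r / 2` of its tag has any two points within `r` of each other, so
its tag may be moved freely inside it. This allows two taggings of one partition to be compared. -/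
theorem exists_retag {I : Box ι} {c : NNReal} {r : ℝ} (hr : 0 < r) (π : TaggedPrepartition I)
    (hπ : IntegrationParams.Riemann.MemBaseSet I c (fun _ => ⟨r / 2, half_pos hr⟩) π)
    (s : Box ι → ι → ℝ) (hs : ∀ J, s J ∈ Box.Icc J) :
    ∃ π' : TaggedPrepartition I, π'.toPrepartition = π.toPrepartition ∧
      (∀ J ∈ π, π'.tag J = s J) ∧
      IntegrationParams.Riemann.MemBaseSet I c (fun _ => ⟨r, hr⟩) π' := by
  classical
  refine ⟨⟨π.toPrepartition, fun J => if J ∈ π then s J else π.tag J, fun J => ?_⟩, rfl,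
    fun J hJ => if_pos hJ, ?_, ?_, ?_, ?_⟩
  · by_cases hJ : J ∈ π
    · simpa only [if_pos hJ] using Box.le_iff_Icc.1 (π.le_of_mem' J hJ) (hs J)
    · simpa only [if_neg hJ] using π.tag_mem_Icc J
  · intro J hJ x hx
    have hJ' : J ∈ π := hJ
    have h1 := hπ.isSubordinate J hJ' hx
    have h2 := hπ.isSubordinate J hJ' (hs J)
    simp only [if_pos hJ', Metric.mem_closedBall] at h1 h2 ⊢
    linarith [dist_triangle_right x (s J) (π.tag J)]
  · intro _ J hJ
    have hJ' : J ∈ π := hJ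
    simpa only [if_pos hJ'] using hs J
  · intro h
    exact absurd h (by decide)
  · intro h
    exact absurd h (by decide)

/-- Interior points are needed so that the nearby `y` witnessing the oscillation stays in `J`. The
difference is kept nonnegative on every box so that boxes can later be dropped from a sum. -/
theorem exists_oscillation_pair (f : (ι → ℝ) → ℝ) (ε : ℝ) (J : Box ι) :
    ∃ a b, a ∈ Box.Icc J ∧ b ∈ Box.Icc J ∧ 0 ≤ f b - f a ∧
      ((Box.Ioo J ∩ oscSet f ε).Nonempty → ε ≤ f b - f a) := by
  by_cases h : (Box.Ioo J ∩ oscSet f ε).Nonempty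
  · obtain ⟨x, hx, hxo⟩ := h
    have hopen : IsOpen (Box.Ioo J) := isOpen_set_pi finite_univ fun _ _ => isOpen_Ioo
    obtain ⟨y, hy, hyJ⟩ := (hxo.and_eventually (hopen.mem_nhds hx)).exists
    have hx' := Box.Ioo_subset_Icc J hx
    have hy' := Box.Ioo_subset_Icc J hyJ
    rcases le_total (f x) (f y) with hle | hle
    · rw [abs_of_nonneg (sub_nonneg.2 hle)] at hy
      exact ⟨x, y, hx', hy', sub_nonneg.2 hle, fun _ => hy⟩
    · rw [abs_sub_comm, abs_of_nonneg (sub_nonneg.2 hle)] at hy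
      exact ⟨y, x, hy', hx', sub_nonneg.2 hle, fun _ => hy⟩
  · exact ⟨J.upper, J.upper, J.upper_mem_Icc, J.upper_mem_Icc, (sub_self _).ge,
      fun h' => absurd h' h⟩

/-- By the Cauchy criterion, the Riemann sums of one fine partition with tags `b J` and `a J` differ
by at most `ε * η`. Each box with an oscillation point in its interior contributes at least `ε`
times its volume, so these boxes have total volume at most `η`. -/
theorem measure_oscSet_eq_zero {I : Box ι} {f : (ι → ℝ) → ℝ}
    (hf : BoxIntegral.Integrable I IntegrationParams.Riemann f BoxAdditiveMap.volume)
    {ε : ℝ} (hε : 0 < ε) : volume ((I : Set (ι → ℝ)) ∩ oscSet f ε) = 0 := by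
  classical
  -- The summand `0` accounts for the faces of the boxes, `η` for the boxes with oscillation in the
  -- interior.
  suffices h : ∀ η : NNReal, 0 < η → volume ((I : Set (ι → ℝ)) ∩ oscSet f ε) ≤ 0 + (η : ℝ≥0∞) by
    refine le_antisymm (ENNReal.le_of_forall_pos_le_add fun η hη _ => h η hη) (zero_le)
  intro η hη
  obtain ⟨r, hrc, hr⟩ := integrable_iff_cauchy_basis.1 hf (ε * η) (by positivity)
  set c := I.distortion
  set r₀ : ℝ := (r c 0 : ℝ)
  have hr₀ : 0 < r₀ := (r c 0).2
  -- For Riemann integration the gauge is constant.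
  have hrr : r c = fun _ => ⟨r₀, hr₀⟩ := funext fun x => hrc c rfl x
  obtain ⟨π, hπ, hπp⟩ := IntegrationParams.Riemann.exists_memBaseSet_isPartition I
    (le_refl c) (fun _ => ⟨r₀ / 2, half_pos hr₀⟩)
  choose a b ha hb hab hosc using exists_oscillation_pair f ε
  obtain ⟨π₁, hb₁, ht₁, hm₁⟩ := exists_retag hr₀ π hπ a ha
  obtain ⟨π₂, hb₂, ht₂, hm₂⟩ := exists_retag hr₀ π hπ b hb
  have hd := hr c c π₂ π₁ (hrr ▸ hm₂) (by
    unfold TaggedPrepartition.IsPartition; rw [hb₂]; exact hπp) (hrr ▸ hm₁) (by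
    unfold TaggedPrepartition.IsPartition; rw [hb₁]; exact hπp)
  have hsum : ∑ J ∈ π.boxes, volume.real (J : Set (ι → ℝ)) * (f (b J) - f (a J)) ≤ ε * η := by
    refine le_trans (le_of_eq ?_) ((le_abs_self _).trans hd)
    unfold integralSum
    rw [hb₁, hb₂, ← Finset.sum_sub_distrib]
    refine Finset.sum_congr rfl fun J hJ => ?_
    rw [ht₁ J hJ, ht₂ J hJ, ← map_sub]
    rfl
  set B := π.boxes.filter fun J => (Box.Ioo J ∩ oscSet f ε).Nonempty with hB
  have hBsum : ∑ J ∈ B, volume.real (J : Set (ι → ℝ)) ≤ η := by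
    refine le_of_mul_le_mul_left ?_ hε
    refine le_trans ?_ hsum
    rw [Finset.mul_sum]
    refine le_trans (Finset.sum_le_sum fun J hJ => ?_)
      (Finset.sum_le_sum_of_subset_of_nonneg (Finset.filter_subset _ _) fun J _ _ =>
        mul_nonneg measureReal_nonneg (hab J))
    rw [mul_comm]
    exact mul_le_mul_of_nonneg_left (hosc J (Finset.mem_filter.1 hJ).2) measureReal_nonneg
  have hcover : (I : Set (ι → ℝ)) ∩ oscSet f ε ⊆
      (⋃ J ∈ π.boxes, ((J : Set (ι → ℝ)) \ Box.Ioo J)) ∪ ⋃ J ∈ B, (J : Set (ι → ℝ)) := by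
    rintro x ⟨hxI, hxo⟩
    obtain ⟨J, hJ, hxJ⟩ := hπp x hxI
    by_cases hx : x ∈ Box.Ioo J
    · exact Or.inr (mem_biUnion (Finset.mem_filter.2 ⟨hJ, x, hx, hxo⟩) hxJ)
    · exact Or.inl (mem_biUnion (x := J) hJ ⟨hxJ, hx⟩)
  refine (measure_mono hcover).trans ((measure_union_le _ _).trans (add_le_add ?_ ?_))
  · refine le_of_eq ((measure_biUnion_null_iff (Finset.countable_toSet _)).2 fun J _ => ?_)
    refine measure_mono_null (sdiff_subset_sdiff_left J.coe_subset_Icc) ?_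
    exact ae_le_set.1 (Box.Ioo_ae_eq_Icc J).symm.le
  · refine (measure_biUnion_finset_le _ _).trans ?_
    rw [← ENNReal.ofReal_coe_nnreal]
    refine le_trans (le_of_eq ?_) (ENNReal.ofReal_le_ofReal hBsum)
    rw [ENNReal.ofReal_sum_of_nonneg fun _ _ => measureReal_nonneg]
    exact Finset.sum_congr rfl fun J _ =>
      (ENNReal.ofReal_toReal (J.measure_coe_lt_top volume).ne).symm

/-- One half of Lebesgue's criterion: a Riemann integrable function is almost everywhere
continuous. -/
theorem ae_continuousAt_of_riemann_integrable {I : Box ι} {f : (ι → ℝ) → ℝ}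
    (hf : BoxIntegral.Integrable I IntegrationParams.Riemann f BoxAdditiveMap.volume) :
    ∀ᵐ x, x ∈ (I : Set (ι → ℝ)) → ContinuousAt f x := by
  have h : ∀ᵐ x, ∀ n : ℕ, ¬ x ∈ (I : Set (ι → ℝ)) ∩ oscSet f (1 / ((n : ℝ) + 1)) :=
    ae_all_iff.2 fun n => measure_eq_zero_iff_ae_notMem.1
      (measure_oscSet_eq_zero hf Nat.one_div_pos_of_nat)
  filter_upwards [h] with x hx hxI
  refine Metric.tendsto_nhds.2 fun ε hε => ?_
  obtain ⟨n, hn⟩ := exists_nat_one_div_lt hε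
  have := not_frequently.1 fun hxo => hx n ⟨hxI, hxo⟩
  filter_upwards [this] with y hy
  exact (not_le.1 hy).trans hn

end BoxIntegral
end RiemannFourier

namespace RiemannFourier

/-! ### Lebesgue's criterion on the line and improper integrals -/

section Criterion

variable {f h : ℝ → ℝ} {a b : ℝ}

theorem RiemannIntegrableOn.ae_continuousAt (hf : RiemannIntegrableOn f a b) :
    ∀ᵐ x, x ∈ Ioc a b → ContinuousAt f x := by
  obtain ⟨hab, hf⟩ := hf
  have h1 := ae_continuousAt_of_riemann_integrable hf
  have h2 := (volume_preserving_funUnique (Fin 1) ℝ).symm.quasiMeasurePreserving.ae h1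
  filter_upwards [h2] with x hx hxI
  have h3 := hx (fun _ => hxI)
  exact ContinuousAt.comp (f := fun y : ℝ => fun _ : Fin 1 => y)
    (g := fun z : Fin 1 → ℝ => f (z 0)) h3 (by fun_prop)

theorem hasIntegral_of_ae_continuousAt (hab : a < b) (hb : ∃ C, ∀ x, |f x| ≤ C)
    (hc : ∀ᵐ x, ContinuousAt f x) :
    BoxIntegral.HasIntegral (intervalBox a b hab) BoxIntegral.IntegrationParams.Riemann
      (fun x : Fin 1 → ℝ => f (x 0)) BoxIntegral.BoxAdditiveMap.volume
      (∫ x in Ioc a b, f x) := by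
  have hmp := volume_preserving_funUnique (Fin 1) ℝ
  have hc' : ∀ᵐ x : Fin 1 → ℝ, ContinuousAt (fun x : Fin 1 → ℝ => f (x 0)) x := by
    filter_upwards [hmp.quasiMeasurePreserving.ae hc] with x hx
    exact ContinuousAt.comp (g := f) (f := fun z : Fin 1 → ℝ => z 0) hx
      (continuous_apply (0 : Fin 1)).continuousAt
  obtain ⟨C, hC⟩ := hb
  have hI := MeasureTheory.AEContinuous.hasBoxIntegral (I := intervalBox a b hab) volume
    ⟨C, fun x _ => hC (x 0)⟩ hc' BoxIntegral.IntegrationParams.Riemann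
  have hpre : (intervalBox a b hab : Set (Fin 1 → ℝ)) =
      MeasurableEquiv.funUnique (Fin 1) ℝ ⁻¹' Ioc a b := by
    ext x
    exact ⟨fun hx => hx 0, fun hx i => by rw [Subsingleton.elim i 0]; exact hx⟩
  rw [hpre] at hI
  have hint := hmp.setIntegral_preimage_emb (MeasurableEquiv.measurableEmbedding _) f (Ioc a b)
  rw [← hint]
  exact hI

theorem riemannIntegrableOn_of_ae_continuousAt (hab : a < b) (hb : ∃ C, ∀ x, |f x| ≤ C)
    (hc : ∀ᵐ x, ContinuousAt f x) : RiemannIntegrableOn f a b :=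
  ⟨hab, _, hasIntegral_of_ae_continuousAt hab hb hc⟩

theorem riemannIntegral_eq_integral (hab : a < b) (hb : ∃ C, ∀ x, |f x| ≤ C)
    (hc : ∀ᵐ x, ContinuousAt f x) : riemannIntegral f a b = ∫ x in Ioc a b, f x := by
  rw [riemannIntegral, dif_pos hab]
  exact (hasIntegral_of_ae_continuousAt hab hb hc).integral_eq

theorem ae_continuousAt_of_forall_riemannIntegrableOn
    (hf : ∀ R : ℝ, 0 < R → RiemannIntegrableOn f (-R) R) : ∀ᵐ x, ContinuousAt f x := by
  have h1 : ∀ᵐ x, ∀ n : ℕ, x ∈ Ioc (-((n : ℝ) + 1)) ((n : ℝ) + 1) → ContinuousAt f x :=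
    ae_all_iff.2 fun n => (hf _ n.cast_add_one_pos).ae_continuousAt
  filter_upwards [h1] with x hx
  obtain ⟨n, hn⟩ := exists_nat_gt |x|
  obtain ⟨h2, h3⟩ := abs_lt.1 hn
  exact hx n ⟨by linarith, by linarith⟩

theorem abs_clamp_le {M : ℝ} (hM : 0 ≤ M) (y : ℝ) : |max (-M) (min y M)| ≤ M :=
  abs_le.2 ⟨le_max_left _ _, max_le (by linarith) (min_le_right _ _)⟩

/-- The truncations of a function are all Riemann integrable if and only if it is almost
everywhere continuous. -/
theorem locallyRiemann_iff : LocallyRiemann f ↔ ∀ᵐ x, ContinuousAt f x := by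
  constructor
  · intro hf
    have h1 : ∀ᵐ x, ∀ n : ℕ, ContinuousAt (fun x => max (-((n : ℝ) + 1)) (min (f x) (n + 1))) x :=
      ae_all_iff.2 fun n => ae_continuousAt_of_forall_riemannIntegrableOn fun R hR =>
        hf _ R n.cast_add_one_pos hR
    filter_upwards [h1] with x hx
    obtain ⟨n, hn⟩ := exists_nat_gt |f x|
    obtain ⟨h2, h3⟩ := abs_lt.1 hn
    have hval : max (-((n : ℝ) + 1)) (min (f x) (n + 1)) = f x := by
      rw [min_eq_left (by linarith), max_eq_right (by linarith)]
    have h4 := (hx n).tendsto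
    -- The truncation at a level above `|f x|` is continuous at `x` and stays strictly inside its
    -- bounds nearby, so there it coincides with `f`.
    rw [hval] at h4
    refine h4.congr' ?_
    filter_upwards [h4.eventually (Ioo_mem_nhds (a := -((n : ℝ) + 1)) (b := n + 1)
      (by linarith) (by linarith))] with y hy
    obtain ⟨h5, h6⟩ := hy
    have h7 : f y < n + 1 := by
      by_contra hle
      rw [min_eq_right (not_lt.1 hle)] at h6
      exact absurd (le_max_right _ _) (not_le.2 h6)
    rw [min_eq_left h7.le] at h5 ⊢
    rcases lt_max_iff.1 h5 with h8 | h8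
    · exact absurd h8 (lt_irrefl _)
    · exact max_eq_right h8.le
  · intro hf M R hM hR
    refine riemannIntegrableOn_of_ae_continuousAt (by linarith) ⟨M, fun x => abs_clamp_le hM.le _⟩ ?_
    filter_upwards [hf] with x hx
    exact continuousAt_const.max (hx.min continuousAt_const)

theorem ae_continuousAt_of_forall_min
    (hf : ∀ M R : ℝ, 0 < M → 0 < R → RiemannIntegrableOn (fun x => min (h x) M) (-R) R)
    (h0 : ∀ x, 0 ≤ h x) : ∀ᵐ x, ContinuousAt h x := by
  refine locallyRiemann_iff.1 fun M R hM hR => ?_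
  convert hf M R hM hR using 2 with x
  exact max_eq_right (by linarith [le_min (h0 x) hM.le])

theorem abs_min_le {y M : ℝ} (hy : 0 ≤ y) (hM : 0 ≤ M) : |min y M| ≤ M := by
  rw [abs_of_nonneg (le_min hy hM)]
  exact min_le_right _ _

/-- The set of continuity points is measurable and of full measure, and `g` is continuous on it. -/
theorem aestronglyMeasurable_of_ae_continuousAt {E : Type*} [PseudoEMetricSpace E]
    [SecondCountableTopology E] {g : ℝ → E} (hg : ∀ᵐ x, ContinuousAt g x) :
    AEStronglyMeasurable g volume := by
  have hm : AEStronglyMeasurable g (volume.restrict {x | ContinuousAt g x}) :=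
    (continuousOn_of_forall_continuousAt fun _ h => h).aestronglyMeasurable
      (measurableSet_of_continuousAt g)
  rwa [Measure.restrict_eq_self_of_ae_mem (s := {x | ContinuousAt g x}) hg] at hm

/-- Dominated convergence along the product filter, with `h` itself as the bound; at each fixed
point the truncated integrand is eventually equal to `h`. -/
theorem hasImproperRiemannIntegral_of_integrable (h0 : ∀ x, 0 ≤ h x)
    (hc : ∀ᵐ x, ContinuousAt h x) (hi : Integrable h) :
    HasImproperRiemannIntegral h (∫ x, h x) := by
  have hcM : ∀ M : ℝ, ∀ᵐ x, ContinuousAt (fun x => min (h x) M) x := fun M => by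
    filter_upwards [hc] with x hx
    exact hx.min continuousAt_const
  refine ⟨fun M R hM hR => riemannIntegrableOn_of_ae_continuousAt (by linarith)
    ⟨M, fun x => abs_min_le (h0 x) hM.le⟩ (hcM M), ?_⟩
  have hpos : ∀ᶠ q : ℝ × ℝ in atTop ×ˢ atTop, 0 < q.1 ∧ 0 < q.2 :=
    (eventually_gt_atTop 0).prod_mk (eventually_gt_atTop 0)
  have hev : (fun q : ℝ × ℝ => ∫ x, (Ioc (-q.2) q.2).indicator (fun x => min (h x) q.1) x)
      =ᶠ[atTop ×ˢ atTop]
      fun q : ℝ × ℝ => riemannIntegral (fun x => min (h x) q.1) (-q.2) q.2 := by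
    filter_upwards [hpos] with q hq
    rw [riemannIntegral_eq_integral (by linarith) ⟨q.1, fun x => abs_min_le (h0 x) hq.1.le⟩
      (hcM q.1), integral_indicator measurableSet_Ioc]
  refine Tendsto.congr' hev (tendsto_integral_filter_of_dominated_convergence h ?_ ?_ hi ?_)
  · exact Eventually.of_forall fun q => (aestronglyMeasurable_of_ae_continuousAt (hcM q.1)).indicator
      measurableSet_Ioc
  · filter_upwards [hpos] with q hq
    refine Eventually.of_forall fun x => ?_
    refine (norm_indicator_le_norm_self _ _).trans ?_
    rw [Real.norm_of_nonneg (le_min (h0 x) hq.1.le)]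
    exact min_le_left _ _
  · refine Eventually.of_forall fun x => tendsto_const_nhds.congr' ?_
    filter_upwards [(eventually_ge_atTop (h x)).prod_mk (eventually_gt_atTop |x|)] with q hq
    obtain ⟨h2, h3⟩ := abs_lt.1 hq.2
    rw [indicator_of_mem (show x ∈ Ioc (-q.2) q.2 from ⟨h2, h3.le⟩), min_eq_left hq.1]

/-- Monotone convergence along the diagonal `M = R = n + 1`, where both parameters are positive even
for `n = 0`. -/
theorem HasImproperRiemannIntegral.integrable {c : ℝ} (h0 : ∀ x, 0 ≤ h x)
    (H : HasImproperRiemannIntegral h c) : Integrable h := by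
  have hc := ae_continuousAt_of_forall_min H.1 h0
  have hcM : ∀ M : ℝ, ∀ᵐ x, ContinuousAt (fun x => min (h x) M) x := fun M => by
    filter_upwards [hc] with x hx
    exact hx.min continuousAt_const
  set F : ℕ → ℝ → ℝ := fun n =>
    (Ioc (-((n : ℝ) + 1)) ((n : ℝ) + 1)).indicator fun x => min (h x) (n + 1) with hF
  have hF0 : ∀ n x, 0 ≤ F n x := fun n x =>
    indicator_nonneg (fun x _ => le_min (h0 x) n.cast_add_one_pos.le) x
  have hFm : ∀ n, AEStronglyMeasurable (F n) volume := fun n =>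
    (aestronglyMeasurable_of_ae_continuousAt (hcM _)).indicator measurableSet_Ioc
  have hFi : ∀ n, Integrable (F n) := fun n => by
    rw [hF, integrable_indicator_iff measurableSet_Ioc]
    refine IntegrableOn.of_bound measure_Ioc_lt_top
      (aestronglyMeasurable_of_ae_continuousAt (hcM _)).restrict (n + 1) (Eventually.of_forall fun x => ?_)
    exact abs_min_le (h0 x) n.cast_add_one_pos.le
  have hn : Tendsto (fun n : ℕ => (n : ℝ) + 1) atTop atTop :=
    tendsto_atTop_add_const_right _ _ tendsto_natCast_atTop_atTop
  have hlim : Tendsto (fun n => ∫ x, F n x) atTop (𝓝 c) := by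
    refine (H.2.comp (hn.prodMk hn)).congr fun n => ?_
    have hp : (0 : ℝ) < n + 1 := n.cast_add_one_pos
    simp only [Function.comp]
    rw [riemannIntegral_eq_integral (by linarith) ⟨n + 1, fun x => abs_min_le (h0 x) hp.le⟩
      (hcM _), hF, integral_indicator measurableSet_Ioc]
  have hlim2 : Tendsto (fun n => ∫⁻ x, ENNReal.ofReal (F n x)) atTop (𝓝 (ENNReal.ofReal c)) := by
    refine (ENNReal.tendsto_ofReal hlim).congr fun n => ?_
    exact ofReal_integral_eq_lintegral_ofReal (hFi n) (Eventually.of_forall (hF0 n))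
  have hlim3 : Tendsto (fun n => ∫⁻ x, ENNReal.ofReal (F n x)) atTop
      (𝓝 (∫⁻ x, ENNReal.ofReal (h x))) := by
    refine lintegral_tendsto_of_tendsto_of_monotone (fun n => (hFm n).aemeasurable.ennreal_ofReal)
      (Eventually.of_forall fun x m n hmn => ENNReal.ofReal_le_ofReal ?_)
      (Eventually.of_forall fun x => ENNReal.tendsto_ofReal (tendsto_const_nhds.congr' ?_))
    · have hmn' : (m : ℝ) + 1 ≤ n + 1 := by exact_mod_cast Nat.succ_le_succ hmn
      by_cases hx : x ∈ Ioc (-((m : ℝ) + 1)) (m + 1)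
      · have hx' : x ∈ Ioc (-((n : ℝ) + 1)) (n + 1) := ⟨by linarith [hx.1], hx.2.trans hmn'⟩
        simp only [hF, indicator_of_mem hx, indicator_of_mem hx']
        exact min_le_min_left _ hmn'
      · rw [show F m x = 0 from indicator_of_notMem hx _]
        exact hF0 n x
    · filter_upwards [hn.eventually ((eventually_ge_atTop (h x)).and
        (eventually_gt_atTop |x|))] with n hq
      obtain ⟨h2, h3⟩ := abs_lt.1 hq.2
      rw [hF]
      simp only
      rw [indicator_of_mem (by exact ⟨h2, h3.le⟩), min_eq_left hq.1]
  refine ⟨aestronglyMeasurable_of_ae_continuousAt hc, ?_⟩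
  rw [hasFiniteIntegral_iff_ofReal (Eventually.of_forall h0),
    tendsto_nhds_unique hlim3 hlim2]
  exact ENNReal.ofReal_lt_top

/-- A nonnegative function has a finite improper Riemann integral if and only if it is almost
everywhere continuous and Lebesgue integrable. -/
theorem improperRiemannIntegrable_iff (h0 : ∀ x, 0 ≤ h x) :
    ImproperRiemannIntegrable h ↔ (∀ᵐ x, ContinuousAt h x) ∧ Integrable h :=
  ⟨fun ⟨_, H⟩ => ⟨ae_continuousAt_of_forall_min H.1 h0, H.integrable h0⟩,
    fun ⟨hc, hi⟩ => ⟨_, hasImproperRiemannIntegral_of_integrable h0 hc hi⟩⟩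

theorem improperRiemannIntegral_eq_integral (h0 : ∀ x, 0 ≤ h x)
    (H : ImproperRiemannIntegrable h) : improperRiemannIntegral h = ∫ x, h x := by
  obtain ⟨hc, hi⟩ := (improperRiemannIntegrable_iff h0).1 H
  rw [improperRiemannIntegral, dif_pos H]
  exact tendsto_nhds_unique H.choose_spec.2 (hasImproperRiemannIntegral_of_integrable h0 hc hi).2

end Criterion

/-! ### The Riemann spaces inside `L^p` -/

section RiemannLp

variable {p : ℝ≥0∞} {f : ℝ → ℂ}

/-- The space `RiemannLp p` consists of the almost everywhere continuous functions in `L^p`. -/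
theorem mem_riemannLp_iff (hp0 : p ≠ 0) (hp : p ≠ ∞) :
    f ∈ RiemannLp p ↔ (∀ᵐ x, ContinuousAt f x) ∧ MemLp f p volume := by
  have h0 : ∀ x, 0 ≤ ‖f x‖ ^ p.toReal := fun x => Real.rpow_nonneg (norm_nonneg _) _
  have hp' : 0 ≤ p.toReal := ENNReal.toReal_nonneg
  simp only [RiemannLp, mem_ofPred_eq, locallyRiemann_iff, improperRiemannIntegrable_iff h0]
  constructor
  · rintro ⟨hre, him, -, hi⟩
    have hc : ∀ᵐ x, ContinuousAt f x := by
      filter_upwards [hre, him] with x h1 h2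
      have h3 : ContinuousAt (fun x => ((f x).re : ℂ) + (f x).im * Complex.I) x :=
        (Complex.continuous_ofReal.continuousAt.comp h1).add
          ((Complex.continuous_ofReal.continuousAt.comp h2).mul continuousAt_const)
      simpa only [Complex.re_add_im] using h3
    exact ⟨hc, (integrable_norm_rpow_iff (aestronglyMeasurable_of_ae_continuousAt hc) hp0 hp).1 hi⟩
  · rintro ⟨hc, hi⟩
    refine ⟨?_, ?_, ?_, (integrable_norm_rpow_iff hi.1 hp0 hp).2 hi⟩
    · filter_upwards [hc] with x hx using Complex.continuous_re.continuousAt.comp hx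
    · filter_upwards [hc] with x hx using Complex.continuous_im.continuousAt.comp hx
    · filter_upwards [hc] with x hx using hx.norm.rpow_const (Or.inr hp')

theorem riemannLpNorm_eq (hp0 : p ≠ 0) (hp : p ≠ ∞) (hf : f ∈ RiemannLp p) :
    riemannLpNorm p f = (eLpNorm f p volume).toReal := by
  have h0 : ∀ x, 0 ≤ ‖f x‖ ^ p.toReal := fun x => Real.rpow_nonneg (norm_nonneg _) _
  have hm := ((mem_riemannLp_iff hp0 hp).1 hf).2
  rw [riemannLpNorm, improperRiemannIntegral_eq_integral h0 hf.2.2,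
    hm.eLpNorm_eq_integral_rpow_norm hp0 hp, ENNReal.toReal_ofReal, one_div]
  exact Real.rpow_nonneg (integral_nonneg h0) _

/-- `RiemannLp p` as a subspace. -/
def riemannLpSubmodule (p : ℝ≥0∞) : Submodule ℂ (ℝ → ℂ) where
  carrier := {f | (∀ᵐ x, ContinuousAt f x) ∧ MemLp f p volume}
  add_mem' := fun ⟨h1, h2⟩ ⟨h3, h4⟩ =>
    ⟨by filter_upwards [h1, h3] with x hx hy using hx.add hy, h2.add h4⟩
  zero_mem' := ⟨Eventually.of_forall fun _ => continuousAt_const, MemLp.zero⟩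
  smul_mem' := fun c _ ⟨h1, h2⟩ =>
    ⟨by filter_upwards [h1] with x hx using hx.const_smul c, h2.const_smul c⟩

theorem coe_riemannLpSubmodule (hp0 : p ≠ 0) (hp : p ≠ ∞) :
    (riemannLpSubmodule p : Set (ℝ → ℂ)) = RiemannLp p :=
  Set.ext fun _ => (mem_riemannLp_iff hp0 hp).symm

end RiemannLp

end RiemannFourier

namespace RiemannFourier

/-! ### The dense set `A` of small measure, and incompleteness -/

section OpenCover

variable {ℓ : ℝ} {q : ℕ → ℝ}

/-- The `j`-th of the intervals whose union is `openCover ℓ q`. -/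
def coverInterval (ℓ : ℝ) (q : ℕ → ℝ) (j : ℕ) : Set ℝ :=
  Icc 0 1 ∩ Ioo (q j - ℓ / 2 ^ (j + 2)) (q j + ℓ / 2 ^ (j + 2))

/-- The union of the first `n` of the intervals whose union is `openCover ℓ q`. -/
def partialCover (ℓ : ℝ) (q : ℕ → ℝ) (n : ℕ) : Set ℝ :=
  ⋃ j ∈ Finset.range n, coverInterval ℓ q j

theorem measurableSet_coverInterval (j : ℕ) : MeasurableSet (coverInterval ℓ q j) :=
  measurableSet_Icc.inter measurableSet_Ioo

theorem measurableSet_openCover : MeasurableSet (openCover ℓ q) :=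
  MeasurableSet.iUnion fun j => measurableSet_coverInterval j

theorem measurableSet_partialCover (n : ℕ) : MeasurableSet (partialCover ℓ q n) :=
  Finset.measurableSet_biUnion _ fun j _ => measurableSet_coverInterval j

theorem partialCover_subset (n : ℕ) : partialCover ℓ q n ⊆ openCover ℓ q :=
  iUnion₂_subset fun j _ => subset_iUnion (fun j => coverInterval ℓ q j) j

theorem volume_openCover_le (hℓ : 0 < ℓ) : volume (openCover ℓ q) ≤ ENNReal.ofReal ℓ := by
  have hs : Summable fun j : ℕ => ℓ / 2 / 2 ^ j := summable_geometric_two' ℓ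
  refine (measure_iUnion_le _).trans ?_
  -- The `j`-th interval has length at most `ℓ / 2 / 2 ^ j`, and these lengths sum to `ℓ`.
  conv_rhs => rw [← tsum_geometric_two' ℓ]
  rw [ENNReal.ofReal_tsum_of_nonneg (fun j => by positivity) hs]
  refine ENNReal.tsum_le_tsum fun j => (measure_mono inter_subset_right).trans (le_of_eq ?_)
  rw [Real.volume_Ioo]
  congr 1
  rw [pow_add]
  ring

theorem volume_openCover_lt_top (hℓ : 0 < ℓ) : volume (openCover ℓ q) < ∞ :=
  (volume_openCover_le hℓ).trans_lt ENNReal.ofReal_lt_top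

theorem memLp_indG (hℓ : 0 < ℓ) (p : ℝ≥0∞) : MemLp (indG ℓ q) p volume :=
  memLp_indicator_const p measurableSet_openCover 1 (Or.inr (volume_openCover_lt_top hℓ).ne)

/-- The indicator function of a union of finitely many of the intervals. -/
noncomputable def partialInd (ℓ : ℝ) (q : ℕ → ℝ) (n : ℕ) : ℝ → ℂ :=
  (partialCover ℓ q n).indicator fun _ => 1

theorem memLp_partialInd (hℓ : 0 < ℓ) (n : ℕ) (p : ℝ≥0∞) :
    MemLp (partialInd ℓ q n) p volume :=
  memLp_indicator_const p (measurableSet_partialCover n) 1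
    (Or.inr (measure_mono (partialCover_subset n) |>.trans_lt (volume_openCover_lt_top hℓ)).ne)

/-- Each interval is convex, so its frontier is null, and the frontier of a finite union lies in the
union of the frontiers. -/
theorem volume_frontier_partialCover (n : ℕ) : volume (frontier (partialCover ℓ q n)) = 0 := by
  induction n with
  | zero => simp [partialCover]
  | succ n ih =>
    have h1 : partialCover ℓ q (n + 1) = coverInterval ℓ q n ∪ partialCover ℓ q n := by
      simp only [partialCover, Finset.range_add_one, Finset.set_biUnion_insert]
    rw [h1]
    refine measure_mono_null (frontier_union_subset _ _) (measure_union_null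
      (measure_mono_null inter_subset_left ?_) (measure_mono_null inter_subset_right ih))
    exact ((convex_Icc 0 1).inter (convex_Ioo _ _)).addHaar_frontier volume

theorem ae_continuousAt_partialInd (n : ℕ) : ∀ᵐ x, ContinuousAt (partialInd ℓ q n) x := by
  filter_upwards [measure_eq_zero_iff_ae_notMem.1 (volume_frontier_partialCover n)] with x hx
  exact continuousOn_const.continuousAt_indicator hx

/-- The norm is the `1 / p`-th power of the measure of the uncovered rest of `A`, which has finite
measure and decreases to the empty set. -/
theorem tendsto_eLpNorm_partialInd_sub_indG (hℓ : 0 < ℓ) {p : ℝ≥0∞} (hp0 : p ≠ 0) (hp : p ≠ ∞) :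
    Tendsto (fun n => eLpNorm (partialInd ℓ q n - indG ℓ q) p volume) atTop (𝓝 0) := by
  have hanti : Antitone fun n => openCover ℓ q \ partialCover ℓ q n := fun m n hmn =>
    sdiff_subset_sdiff_right (biUnion_subset_biUnion_left (Finset.range_subset_range.2 hmn))
  have hinter : ⋂ n, openCover ℓ q \ partialCover ℓ q n = ∅ := by
    refine eq_empty_of_forall_notMem fun x hx => ?_
    rw [mem_iInter] at hx
    obtain ⟨j, hj⟩ := mem_iUnion.1 (hx 0).1
    exact (hx (j + 1)).2 (mem_biUnion (x := j) (by simp) hj)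
  have h1 : Tendsto (fun n => volume (openCover ℓ q \ partialCover ℓ q n)) atTop (𝓝 0) := by
    have := tendsto_measure_iInter_atTop (μ := volume)
      (fun n => (measurableSet_openCover.diff (measurableSet_partialCover n)).nullMeasurableSet)
      hanti ⟨0, ((measure_mono sdiff_subset).trans_lt (volume_openCover_lt_top hℓ)).ne⟩
    rwa [hinter, measure_empty] at this
  have hpos : 0 < p.toReal := ENNReal.toReal_pos hp0 hp
  have h2 := (ENNReal.continuous_rpow_const (y := 1 / p.toReal)).tendsto 0 |>.comp h1
  rw [ENNReal.zero_rpow_of_pos (by positivity)] at h2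
  refine h2.congr fun n => ?_
  have h3 : indG ℓ q - partialInd ℓ q n =
      (openCover ℓ q \ partialCover ℓ q n).indicator fun _ => 1 :=
    (indicator_sdiff (partialCover_subset n) _).symm
  rw [eLpNorm_sub_comm, h3, eLpNorm_indicator_const
    (measurableSet_openCover.diff (measurableSet_partialCover n)) hp0 hp]
  simp

theorem exists_isOpen_subset_openCover (hℓ : 0 < ℓ)
    (hq : range q = range ((↑) : ℚ → ℝ) ∩ Icc 0 1) {U : Set ℝ} (hU : IsOpen U)
    (hne : (U ∩ Ioo 0 1).Nonempty) :
    ∃ V : Set ℝ, IsOpen V ∧ V.Nonempty ∧ V ⊆ U ∧ V ⊆ openCover ℓ q := by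
  obtain ⟨x, hx, r, rfl⟩ := Rat.denseRange_cast.inter_open_nonempty _ (hU.inter isOpen_Ioo) hne
  have hr : (r : ℝ) ∈ range q := by
    rw [hq]
    exact ⟨⟨r, rfl⟩, Ioo_subset_Icc_self hx.2⟩
  obtain ⟨j, hj⟩ := hr
  have hpos : 0 < ℓ / 2 ^ (j + 2) := by positivity
  -- Intersecting with `Ioo 0 1` makes the set open in the line; `A` itself is only relatively open
  -- in `[0, 1]`.
  refine ⟨(U ∩ Ioo 0 1) ∩ Ioo (q j - ℓ / 2 ^ (j + 2)) (q j + ℓ / 2 ^ (j + 2)),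
    (hU.inter isOpen_Ioo).inter isOpen_Ioo, ⟨r, hx, ?_, ?_⟩, fun y hy => hy.1.1,
    fun y hy => mem_iUnion.2 ⟨j, Ioo_subset_Icc_self hy.1.2, hy.2⟩⟩ <;> linarith

/-- No function equal almost everywhere to the indicator function of `openCover ℓ q` is almost
everywhere continuous. -/
theorem not_ae_continuousAt_of_ae_eq (hℓ : 0 < ℓ) (hℓ1 : ℓ < 1)
    (hq : range q = range ((↑) : ℚ → ℝ) ∩ Icc 0 1) {h : ℝ → ℝ}
    (hh : h =ᵐ[volume] (openCover ℓ q).indicator fun _ => 1) :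
    ¬ ∀ᵐ x, ContinuousAt h x := by
  intro hc
  obtain ⟨x, hx, hxA, hxh, hxc⟩ :
      ∃ x ∈ Ioo (0 : ℝ) 1, x ∉ openCover ℓ q ∧
        h x = (openCover ℓ q).indicator (fun _ => 1) x ∧ ContinuousAt h x := by
    -- Otherwise almost all of `(0, 1)` would lie in `A`, forcing `1 ≤ ℓ`.
    by_contra! hno
    have hle : volume (Ioo (0 : ℝ) 1) ≤ volume (openCover ℓ q) := by
      refine measure_mono_ae ?_
      filter_upwards [hh, hc] with x h1 h2 hx
      by_contra hxA
      exact hno x hx hxA h1 h2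
    have := hle.trans (volume_openCover_le hℓ)
    rw [Real.volume_Ioo, ENNReal.ofReal_le_ofReal_iff hℓ.le] at this
    linarith
  rw [indicator_of_notMem hxA] at hxh
  have hlt : ∀ᶠ y in 𝓝 x, h y < 1 := hxc.tendsto.eventually_lt_const (by rw [hxh]; exact one_pos)
  obtain ⟨U, hUlt, hUo, hxU⟩ := eventually_nhds_iff.1 hlt
  obtain ⟨V, hVo, hVne, hVU, hVA⟩ := exists_isOpen_subset_openCover hℓ hq hUo ⟨x, hxU, hx⟩
  -- On `V` the function `h` is below `1` while the indicator is `1`, so the nonempty open set `V`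
  -- would be null.
  refine (hVo.measure_pos volume hVne).ne' (measure_mono_null (fun y hy => ?_) hh)
  intro heq
  have h1 := hUlt y (hVU hy)
  rw [show h y = _ from heq, indicator_of_mem (hVA hy)] at h1
  exact lt_irrefl _ h1

/-- The values `0` and `1` are unchanged by positive powers, so `‖g‖ ^ p` is again almost everywhere
the indicator of `A`. -/
theorem not_improperRiemannIntegrable_of_ae_eq_indG (hℓ : 0 < ℓ) (hℓ1 : ℓ < 1)
    (hq : range q = range ((↑) : ℚ → ℝ) ∩ Icc 0 1) {p : ℝ} (hp : 1 ≤ p) {g : ℝ → ℂ}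
    (hg : g =ᵐ[volume] indG ℓ q) : ¬ ImproperRiemannIntegrable fun x => ‖g x‖ ^ p := by
  intro H
  refine not_ae_continuousAt_of_ae_eq hℓ hℓ1 hq ?_ ((improperRiemannIntegrable_iff fun x =>
    Real.rpow_nonneg (norm_nonneg (g x)) p).1 H).1
  filter_upwards [hg] with x hx
  rw [hx, indG]
  by_cases hxA : x ∈ openCover ℓ q
  · simp [hxA]
  · simp [hxA, Real.zero_rpow (by linarith : p ≠ 0)]

theorem exists_enumeration : ∃ q : ℕ → ℝ, range q = range ((↑) : ℚ → ℝ) ∩ Icc 0 1 := by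
  obtain ⟨q, hq⟩ := ((countable_range ((↑) : ℚ → ℝ)).mono inter_subset_left).exists_eq_range
    (⟨0, ⟨0, Rat.cast_zero⟩, by simp⟩ : (range ((↑) : ℚ → ℝ) ∩ Icc 0 1).Nonempty)
  exact ⟨q, hq.symm⟩

/-- The seminormed space `RiemannLp p` is not complete. -/
theorem exists_cauchySeq_not_tendsto {p : ℝ≥0∞} (hp1 : 1 ≤ p) (hp : p ≠ ∞) :
    ∃ u : ℕ → ℝ → ℂ, (∀ n, u n ∈ RiemannLp p) ∧
      (∀ ε : ℝ, 0 < ε → ∃ N : ℕ, ∀ m ≥ N, ∀ n ≥ N, riemannLpNorm p (u m - u n) < ε) ∧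
      ¬ ∃ f ∈ RiemannLp p, Tendsto (fun n => riemannLpNorm p (u n - f)) atTop (𝓝 0) := by
  obtain ⟨q, hq⟩ := exists_enumeration
  have hℓ : (0 : ℝ) < 1 / 2 := by norm_num
  have hp0 : p ≠ 0 := (one_pos.trans_le hp1).ne'
  have hV := coe_riemannLpSubmodule hp0 hp
  have hmem : ∀ n, partialInd (1 / 2) q n ∈ RiemannLp p := fun n =>
    (mem_riemannLp_iff hp0 hp).2 ⟨ae_continuousAt_partialInd n, memLp_partialInd hℓ n p⟩
  have hsub : ∀ {f g : ℝ → ℂ}, f ∈ RiemannLp p → g ∈ RiemannLp p → f - g ∈ RiemannLp p := by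
    intro f g hf hg
    rw [← hV] at hf hg ⊢
    exact sub_mem hf hg
  have hlim := tendsto_eLpNorm_partialInd_sub_indG (q := q) hℓ hp0 hp
  have hG := memLp_indG (q := q) hℓ p
  refine ⟨partialInd (1 / 2) q, hmem, fun ε hε => ?_, ?_⟩
  · have hε' : (0 : ℝ≥0∞) < ENNReal.ofReal (ε / 2) := ENNReal.ofReal_pos.2 (half_pos hε)
    obtain ⟨N, hN⟩ := eventually_atTop.1 (hlim.eventually_lt_const hε')
    refine ⟨N, fun m hm n hn => ?_⟩
    rw [riemannLpNorm_eq hp0 hp (hsub (hmem m) (hmem n))]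
    refine ENNReal.toReal_lt_of_lt_ofReal ?_
    have h1 := eLpNorm_add_le ((memLp_partialInd (q := q) hℓ m p).sub hG).1
      (hG.sub (memLp_partialInd (q := q) hℓ n p)).1 hp1
    rw [sub_add_sub_cancel] at h1
    refine h1.trans_lt ?_
    rw [← add_halves ε, ENNReal.ofReal_add (half_pos hε).le (half_pos hε).le,
      eLpNorm_sub_comm (indG (1 / 2) q)]
    exact ENNReal.add_lt_add (hN m hm) (hN n hn)
  · rintro ⟨f, hf, hfl⟩
    have hfm := ((mem_riemannLp_iff hp0 hp).1 hf).2
    have hfl' : Tendsto (fun n => eLpNorm (partialInd (1 / 2) q n - f) p volume) atTop (𝓝 0) := by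
      have := ENNReal.tendsto_ofReal hfl
      rw [ENNReal.ofReal_zero] at this
      refine this.congr fun n => ?_
      rw [riemannLpNorm_eq hp0 hp (hsub (hmem n) hf), ENNReal.ofReal_toReal]
      exact ((memLp_partialInd hℓ n p).sub hfm).2.ne
    -- A limit `f` in the Riemann space would also be the `L^p` limit, hence equal to `G` almost
    -- everywhere.
    have hle : ∀ n, eLpNorm (f - indG (1 / 2) q) p volume ≤
        eLpNorm (partialInd (1 / 2) q n - f) p volume +
          eLpNorm (partialInd (1 / 2) q n - indG (1 / 2) q) p volume := fun n => by
      have h1 := eLpNorm_add_le (hfm.sub (memLp_partialInd (q := q) hℓ n p)).1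
        ((memLp_partialInd (q := q) hℓ n p).sub hG).1 hp1
      rwa [sub_add_sub_cancel, eLpNorm_sub_comm f (partialInd (1 / 2) q n)] at h1
    have hzero : eLpNorm (f - indG (1 / 2) q) p volume = 0 := by
      refine le_antisymm ?_ zero_le
      have := ge_of_tendsto' (hfl'.add hlim) hle
      rwa [add_zero] at this
    have hae : f =ᵐ[volume] indG (1 / 2) q :=
      (sub_ae_eq_zero _ _).1 ((eLpNorm_eq_zero_iff (hfm.sub hG).1 hp0).1 hzero)
    have hpr : 1 ≤ p.toReal := by
      simpa using ENNReal.toReal_mono hp hp1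
    exact not_improperRiemannIntegrable_of_ae_eq_indG hℓ (by norm_num) hq hpr hae hf.2.2

end OpenCover

end RiemannFourier

namespace RiemannFourier

/-! ### The inverse `L²` transform on `L¹ ∩ L²` -/

section Fourier

open SchwartzMap

theorem continuous_neg_inner : Continuous fun p : ℝ × ℝ => (-innerₗ ℝ) p.1 p.2 :=
  (continuous_inner (𝕜 := ℝ) (E := ℝ)).neg

/-- The inverse transform has the kernel of the bilinear form `-innerₗ ℝ`, which is symmetric, so
the general exchange formula makes it self-adjoint. -/
theorem integral_fourierInv_smul_eq_of_integrable {f g : ℝ → ℂ} (hf : Integrable f)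
    (hg : Integrable g) : ∫ x, 𝓕⁻ g x • f x = ∫ x, g x • 𝓕⁻ f x := by
  have h := VectorFourier.integral_fourierIntegral_smul_eq_flip (L := -innerₗ ℝ)
    Real.continuous_fourierChar continuous_neg_inner hg hf
  have hflip : (-innerₗ ℝ).flip = -innerₗ ℝ := by
    ext
    simp
  rw [hflip] at h
  exact h

theorem continuous_fourierInv {f : ℝ → ℂ} (hf : Integrable f) : Continuous (𝓕⁻ f) := by
  exact VectorFourier.fourierIntegral_continuous Real.continuous_fourierChar continuous_neg_inner hf

/-- On `L¹ ∩ L²`, the inverse `L²`-Fourier transform is given by the integral formula. -/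
theorem fourierInv_toLp_ae_eq {f : ℝ → ℂ} (h1 : Integrable f) (h2 : MemLp f 2 volume) :
    ((𝓕⁻ (h2.toLp f) : Lp ℂ 2 (volume : Measure ℝ)) : ℝ → ℂ) =ᵐ[volume] 𝓕⁻ f := by
  -- Both sides are locally integrable, so it suffices to test against smooth compactly supported
  -- `g`. As a Schwartz function, `g` takes over the transform in the sense of distributions, and
  -- the self-adjointness for integrable functions moves it back to `f`.
  refine ae_eq_of_integral_contDiff_smul_eq
    ((Lp.memLp _).locallyIntegrable (by norm_num)) (continuous_fourierInv h1).locallyIntegrable ?_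
  intro g g_smooth g_cpt
  have hg₁ : HasCompactSupport (Complex.ofRealCLM ∘ g) := g_cpt.comp_left rfl
  have hg₂ : ContDiff ℝ (⊤ : ℕ∞) (Complex.ofRealCLM ∘ g) := by fun_prop
  set φ : 𝓢(ℝ, ℂ) := hg₁.toSchwartzMap hg₂
  have hφ : ∀ (k : ℝ → ℂ) (x : ℝ), g x • k x = φ x • k x := fun k x => by
    simp [φ]
  simp_rw [hφ]
  rw [← Lp.toTemperedDistribution_apply, ← Lp.fourierInv_toTemperedDistribution_eq,
    TemperedDistribution.fourierInv_apply, Lp.toTemperedDistribution_apply,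
    ← integral_fourierInv_smul_eq_of_integrable h1 φ.integrable]
  refine integral_congr_ae ?_
  filter_upwards [h2.coeFn_toLp] with x hx
  rw [hx, SchwartzMap.fourierInv_coe]

end Fourier

/-! ### The function `F` and its transform -/

section Main

variable {ℓ : ℝ} {q : ℕ → ℝ}

theorem invFT_eq_fourierInv : invFT ℓ q = 𝓕⁻ (indG ℓ q) := by
  ext x
  rw [invFT, Real.fourierInv_eq']
  refine integral_congr_ae (Eventually.of_forall fun t => ?_)
  simp only [smul_eq_mul, RCLike.inner_apply, conj_trivial]
  rw [mul_comm]
  congr 2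
  push_cast
  ring

theorem integrable_indG (hℓ : 0 < ℓ) : Integrable (indG ℓ q) volume :=
  memLp_one_iff_integrable.1 (memLp_indG hℓ 1)

theorem continuous_invFT (hℓ : 0 < ℓ) : Continuous (invFT ℓ q) := by
  rw [invFT_eq_fourierInv]
  exact continuous_fourierInv (integrable_indG hℓ)

theorem memLp_invFT (hℓ : 0 < ℓ) : MemLp (invFT ℓ q) 2 volume := by
  rw [invFT_eq_fourierInv]
  exact (memLp_congr_ae (fourierInv_toLp_ae_eq (integrable_indG hℓ) (memLp_indG hℓ 2))).1
    (Lp.memLp _)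

theorem fourier_toLp_invFT (hℓ : 0 < ℓ) :
    𝓕 ((memLp_invFT (q := q) hℓ).toLp (invFT ℓ q)) = (memLp_indG hℓ 2).toLp (indG ℓ q) := by
  have h : (memLp_invFT (q := q) hℓ).toLp (invFT ℓ q) =
      𝓕⁻ ((memLp_indG (q := q) hℓ 2).toLp (indG ℓ q)) := by
    refine Lp.ext ((memLp_invFT hℓ).coeFn_toLp.trans ?_)
    rw [invFT_eq_fourierInv]
    exact (fourierInv_toLp_ae_eq (integrable_indG hℓ) (memLp_indG hℓ 2)).symm
  rw [h, FourierTransform.fourier_fourierInv_eq]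

theorem invFT_mem_riemannLp (hℓ : 0 < ℓ) : invFT ℓ q ∈ RiemannLp 2 :=
  (mem_riemannLp_iff two_ne_zero ENNReal.ofNat_ne_top).2
    ⟨Eventually.of_forall fun _ => (continuous_invFT hℓ).continuousAt, memLp_invFT hℓ⟩

theorem toLp_invFT_mem_riemannLpHat (hℓ : 0 < ℓ) :
    (memLp_invFT (q := q) hℓ).toLp (invFT ℓ q) ∈ RiemannLpHat 2 :=
  ⟨_, invFT_mem_riemannLp hℓ, MemLp.coeFn_toLp _⟩

theorem toLp_indG_notMem_riemannLpHat (hℓ : 0 < ℓ) (hℓ1 : ℓ < 1)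
    (hq : range q = range ((↑) : ℚ → ℝ) ∩ Icc 0 1) :
    (memLp_indG (q := q) hℓ 2).toLp (indG ℓ q) ∉ RiemannLpHat 2 := by
  rintro ⟨f, hf, hfe⟩
  refine not_improperRiemannIntegrable_of_ae_eq_indG hℓ hℓ1 hq (p := (2 : ℝ≥0∞).toReal)
    (by norm_num) ?_ hf.2.2
  exact hfe.symm.trans (MemLp.coeFn_toLp _)

/-- The Riemann criterion needs a global bound; the `L¹` norm of `G` bounds its inverse transform.
-/
theorem norm_sq_invFT_le (x : ℝ) : |‖invFT ℓ q x‖ ^ 2| ≤ (∫ t, ‖indG ℓ q t‖) ^ 2 := by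
  rw [abs_of_nonneg (sq_nonneg _), invFT_eq_fourierInv]
  exact pow_le_pow_left₀ (norm_nonneg _)
    (VectorFourier.norm_fourierIntegral_le_integral_norm _ _ _ _ _) 2

theorem ae_continuousAt_norm_sq_invFT (hℓ : 0 < ℓ) :
    ∀ᵐ x, ContinuousAt (fun x => ‖invFT ℓ q x‖ ^ 2) x :=
  Eventually.of_forall fun _ => ((continuous_invFT hℓ).norm.pow 2).continuousAt

theorem tendsto_riemannIntegral_norm_sq_invFT (hℓ : 0 < ℓ) :
    Tendsto (fun R : ℝ => riemannIntegral (fun x => ‖invFT ℓ q x‖ ^ 2) (-R) R) atTop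
      (𝓝 (∫ x, ‖invFT ℓ q x‖ ^ 2)) := by
  have hi : Integrable (fun x => ‖invFT ℓ q x‖ ^ 2) :=
    (memLp_two_iff_integrable_sq_norm (memLp_invFT hℓ).1).1 (memLp_invFT hℓ)
  refine (intervalIntegral_tendsto_integral hi tendsto_neg_atTop_atBot tendsto_id).congr' ?_
  filter_upwards [eventually_gt_atTop 0] with R hR
  rw [riemannIntegral_eq_integral (by linarith) ⟨_, norm_sq_invFT_le⟩
    (ae_continuousAt_norm_sq_invFT hℓ), id, intervalIntegral.integral_of_le (by linarith)]

end Main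

end RiemannFourier

theorem mainTheorem5 :
    -- For `1 ≤ p < ∞` the space is a vector space, on which the Riemann and Lebesgue
    -- seminorms agree, and it is not complete.
    (∀ p : ℝ≥0∞, 1 ≤ p → p ≠ ∞ →
      (∃ V : Submodule ℂ (ℝ → ℂ), (V : Set (ℝ → ℂ)) = RiemannLp p) ∧
      (∀ f ∈ RiemannLp p, MemLp f p volume ∧ riemannLpNorm p f = (eLpNorm f p volume).toReal) ∧
      ∃ u : ℕ → ℝ → ℂ, (∀ n, u n ∈ RiemannLp p) ∧
        (∀ ε : ℝ, 0 < ε → ∃ N : ℕ, ∀ m ≥ N, ∀ n ≥ N, riemannLpNorm p (u m - u n) < ε) ∧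
        ¬ ∃ f ∈ RiemannLp p, Tendsto (fun n => riemannLpNorm p (u n - f)) atTop (𝓝 0)) ∧
    -- The Fourier transform on `L²` does not map the Riemann space into itself.
    (¬ MapsTo (fun u : Lp ℂ 2 (volume : Measure ℝ) => 𝓕 u) (RiemannLpHat 2) (RiemannLpHat 2)) ∧
    -- The explicit functions that witness this.
    (∀ (ℓ : ℝ) (q : ℕ → ℝ), 0 < ℓ → ℓ < 1 →
      range q = range ((↑) : ℚ → ℝ) ∩ Icc 0 1 →
      Integrable (indG ℓ q) volume ∧ Continuous (invFT ℓ q) ∧ invFT ℓ q ∈ RiemannLp 2 ∧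
      (∀ R : ℝ, 0 < R → RiemannIntegrableOn (fun x => ‖invFT ℓ q x‖ ^ 2) (-R) R) ∧
      (∃ c : ℝ, Tendsto (fun R : ℝ => riemannIntegral (fun x => ‖invFT ℓ q x‖ ^ 2) (-R) R)
        atTop (𝓝 c)) ∧
      (∃ (hF : MemLp (invFT ℓ q) 2 volume) (hG : MemLp (indG ℓ q) 2 volume),
        hF.toLp (invFT ℓ q) ∈ RiemannLpHat 2 ∧
        𝓕 (hF.toLp (invFT ℓ q)) = hG.toLp (indG ℓ q) ∧
        hG.toLp (indG ℓ q) ∉ RiemannLpHat 2) ∧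
      -- No function that equals `G` almost everywhere has a Riemann integrable power.
      (∀ (p : ℝ) (g : ℝ → ℂ), 1 ≤ p → g =ᵐ[volume] indG ℓ q →
        ¬ ImproperRiemannIntegrable (fun x => ‖g x‖ ^ p))) := by
  refine ⟨fun p hp1 hp => ?_, ?_, fun ℓ q hℓ hℓ1 hq => ?_⟩
  · have hp0 : p ≠ 0 := (one_pos.trans_le hp1).ne'
    exact ⟨⟨riemannLpSubmodule p, coe_riemannLpSubmodule hp0 hp⟩,
      fun f hf => ⟨((mem_riemannLp_iff hp0 hp).1 hf).2, riemannLpNorm_eq hp0 hp hf⟩,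
      exists_cauchySeq_not_tendsto hp1 hp⟩
  · intro h
    obtain ⟨q, hq⟩ := exists_enumeration
    have hℓ : (0 : ℝ) < 1 / 2 := by norm_num
    have h1 := h (toLp_invFT_mem_riemannLpHat (q := q) hℓ)
    simp only [fourier_toLp_invFT hℓ] at h1
    exact toLp_indG_notMem_riemannLpHat hℓ (by norm_num) hq h1
  · exact ⟨integrable_indG hℓ, continuous_invFT hℓ, invFT_mem_riemannLp hℓ,
      fun R hR => riemannIntegrableOn_of_ae_continuousAt (by linarith) ⟨_, norm_sq_invFT_le⟩
        (ae_continuousAt_norm_sq_invFT hℓ),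
      ⟨_, tendsto_riemannIntegral_norm_sq_invFT hℓ⟩,
      ⟨memLp_invFT hℓ, memLp_indG hℓ 2, toLp_invFT_mem_riemannLpHat hℓ, fourier_toLp_invFT hℓ,
        toLp_indG_notMem_riemannLpHat hℓ hℓ1 hq⟩,
      fun p g hp hg => not_improperRiemannIntegrable_of_ae_eq_indG hℓ hℓ1 hq hp hg⟩
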